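/- Let $G$ be a topological Abelian group, written additively. For $f\colon G\to\mathbb{C}$ and $h\in G$ put $\Delta_h f(x)=f(x+h)-f(x)$ $(x\in G)$. A function $f\colon G\to\mathbb{C}$ is called a generalized polynomial if it is continuous and there is an integer $n\ge 0$ such that $\Delta_{h_1}\cdots\Delta_{h_{n+1}}f=0$ for all $h_1,\dots,h_{n+1}\in G$. If $G$ and $H$ are topological Abelian groups, a function $f\colon G\times H\to\mathbb{C}$ is called a separately generalized polynomial function if the section $y\mapsto f(x,y)$ is a generalized polynomial on $H$ for every $x\in G$, and the section $x\mapsto f(x,y)$ is a generalized polynomial on $G$ for every $y\in H$. Theorem. Let $G$ and $H$ be topological Abelian groups that are connected Baire spaces, and suppose that either (i) at least one of $G$ and $H$ is metrizable, or (ii) both $G$ and $H$ are locally compact. Then every separately generalized polynomial function $f\colon G\times H\to\mathbb{C}$ is a generalized polynomial on $G\times H$ (with the product group structure and the product topology). -/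

import Mathlib

/-- A function `f : G → ℂ` on a topological Abelian group is a generalized polynomial if it is
continuous and there is an `n ≥ 0` such that `Δ_{h₁} ⋯ Δ_{hₙ₊₁} f = 0` for all
`h₁, …, hₙ₊₁ ∈ G`, where `Δ_h f (x) = f (x + h) - f x` is Mathlib's `fwdDiff h f`.
The list `l` is `[h₁, …, hₙ₊₁]`. -/
def IsGeneralizedPolynomial {G : Type*} [AddCommGroup G] [TopologicalSpace G]
    (f : G → ℂ) : Prop :=
  Continuous f ∧ ∃ n : ℕ, ∀ l : List G, l.length = n + 1 → l.foldr fwdDiff f = 0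

/-- A function on `G × H` is separately generalized polynomial if all its sections
`f_x : y ↦ f (x, y)` and `f^y : x ↦ f (x, y)` are generalized polynomials, on `H` and on `G`
respectively. -/
def IsSeparatelyGeneralizedPolynomial {G : Type*} {H : Type*}
    [AddCommGroup G] [TopologicalSpace G] [AddCommGroup H] [TopologicalSpace H]
    (f : G × H → ℂ) : Prop :=
  (∀ x : G, IsGeneralizedPolynomial (fun y : H => f (x, y))) ∧
    (∀ y : H, IsGeneralizedPolynomial (fun x : G => f (x, y)))

open Filter Topology

/-! By Baire, some closed set of the `x` whose section has order at most `n` has interior. A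
function of finite order on a connected group that vanishes on an open set is zero, so this bound
spreads to every `x` (`exists_uniform_diffOrder`). Uniform bounds in both variables add up to a
joint order (`DiffOrder.prod`). For continuity, a second Baire argument, the only place where
metrizability or local compactness enters, bounds `f` near one point. For a function of finite order
on a connected group, that forces continuity everywhere (`DiffOrder.continuous_of_bounded`). -/

/-- `f` is annihilated by all products of `n` difference operators. -/
def DiffOrder {G : Type*} [AddCommGroup G] : ℕ → (G → ℂ) → Prop
  | 0, f => f = 0
  | n + 1, f => ∀ h : G, DiffOrder n (fwdDiff h f)

/-! ### Algebra of difference operators -/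

section Algebra

variable {G H : Type*} [AddCommGroup G] [AddCommGroup H]

theorem diffOrder_iff_foldr {n : ℕ} {f : G → ℂ} :
    DiffOrder n f ↔ ∀ l : List G, l.length = n → l.foldr fwdDiff f = 0 := by
  induction n generalizing f with
  | zero => simp [DiffOrder]
  | succ n ih =>
    simp only [DiffOrder, ih]
    constructor
    · intro hf l hl
      have hne : l ≠ [] := by rintro rfl; simp at hl
      have := hf (l.getLast hne) l.dropLast (by simp [hl])
      rw [← List.dropLast_append_getLast hne, List.foldr_append]
      simpa using this
    · intro hf h l hl
      have := hf (l ++ [h]) (by simp [hl])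
      simpa [List.foldr_append] using this

theorem DiffOrder.zero (n : ℕ) : DiffOrder n (0 : G → ℂ) := by
  induction n with
  | zero => rfl
  | succ n ih =>
    intro h
    have : fwdDiff h (0 : G → ℂ) = 0 := by ext; simp [fwdDiff]
    rwa [this]

theorem DiffOrder.succ {n : ℕ} {f : G → ℂ} (hf : DiffOrder n f) : DiffOrder (n + 1) f := by
  induction n generalizing f with
  | zero =>
    obtain rfl : f = 0 := hf
    exact DiffOrder.zero 1
  | succ n ih => exact fun h => ih (hf h)

theorem DiffOrder.mono {m n : ℕ} (hmn : m ≤ n) {f : G → ℂ} (hf : DiffOrder m f) :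
    DiffOrder n f := by
  induction hmn with
  | refl => exact hf
  | step _ ih => exact ih.succ

theorem DiffOrder.sub {n : ℕ} {f g : G → ℂ} (hf : DiffOrder n f) (hg : DiffOrder n g) :
    DiffOrder n (f - g) := by
  induction n generalizing f g with
  | zero =>
    obtain rfl : f = 0 := hf
    obtain rfl : g = 0 := hg
    exact sub_self 0
  | succ n ih =>
    intro h
    have : fwdDiff h (f - g) = fwdDiff h f - fwdDiff h g := by
      ext; simp only [fwdDiff, Pi.sub_apply]; ring
    rw [this]
    exact ih (hf h) (hg h)

theorem DiffOrder.add {n : ℕ} {f g : G → ℂ} (hf : DiffOrder n f) (hg : DiffOrder n g) :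
    DiffOrder n (f + g) := by
  have : f + g = f - (0 - g) := by abel
  rw [this]
  exact hf.sub ((DiffOrder.zero n).sub hg)

theorem DiffOrder.translate {n : ℕ} {f : G → ℂ} (hf : DiffOrder n f) (k : G) :
    DiffOrder n (fun x => f (x + k)) := by
  induction n generalizing f with
  | zero =>
    obtain rfl : f = 0 := hf
    rfl
  | succ n ih =>
    intro h
    have : fwdDiff h (fun x => f (x + k)) = fun x => fwdDiff h f (x + k) := by
      ext x; simp only [fwdDiff, add_right_comm]
    rw [this]
    exact ih (hf h)

/-- A function of bounded order in each variable has bounded order jointly. -/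
theorem DiffOrder.prod {N m n : ℕ} (hN : m + n ≤ N) {f : G × H → ℂ}
    (hx : ∀ y, DiffOrder m (fun x => f (x, y))) (hy : ∀ x, DiffOrder n (fun y => f (x, y))) :
    DiffOrder N f := by
  induction N generalizing m n f with
  | zero =>
    obtain rfl : m = 0 := by omega
    ext ⟨x, y⟩
    exact congrFun (hx y) x
  | succ N ih =>
    rcases m with _ | m
    · have : f = 0 := by ext ⟨x, y⟩; exact congrFun (hx y) x
      exact this ▸ DiffOrder.zero _
    rcases n with _ | n
    · have : f = 0 := by ext ⟨x, y⟩; exact congrFun (hy x) y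
      exact this ▸ DiffOrder.zero _
    rintro ⟨h, k⟩
    -- The first summand is a difference in `G`, lowering `m`; the second is a difference in `H`,
    -- lowering `n`.
    have hsplit : fwdDiff (h, k) f =
        (fun p : G × H => f (p.1 + h, p.2 + k) - f (p.1, p.2 + k)) +
          fun p : G × H => f (p.1, p.2 + k) - f (p.1, p.2) := by
      ext ⟨x, y⟩; simp [fwdDiff]
    rw [hsplit]
    refine DiffOrder.add (ih (m := m) (n := n + 1) (by omega) ?_ ?_)
      (ih (m := m + 1) (n := n) (by omega) ?_ ?_)
    · exact fun y => hx (y + k) h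
    · exact fun x => ((hy (x + h)).translate k).sub ((hy x).translate k)
    · exact fun y => (hx (y + k)).sub (hx y)
    · exact fun x => hy x k

/-- A bounded sequence annihilated by a power of the difference operator is constant. -/
theorem eq_apply_zero_of_bounded_of_iterate_fwdDiff {n : ℕ} {q : ℕ → ℂ} {M : ℝ}
    (hM : ∀ k, ‖q k‖ ≤ M) (hq : (fwdDiff 1)^[n] q = 0) (k : ℕ) : q k = q 0 := by
  induction n generalizing q M k with
  | zero =>
    obtain rfl : q = 0 := hq
    rfl
  | succ n ih =>
    have hd : ∀ j, q (j + 1) - q j = q 1 - q 0 := fun j => by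
      refine ih (q := fwdDiff 1 q) (M := M + M) (fun i => ?_) hq j
      exact (norm_sub_le _ _).trans (add_le_add (hM _) (hM _))
    have hlin : ∀ j : ℕ, q j = q 0 + j * (q 1 - q 0) := by
      intro j
      induction j with
      | zero => simp
      | succ j ihj =>
        have := hd j
        push_cast
        linear_combination this + ihj
    have hc : q 1 - q 0 = 0 := by
      by_contra hne
      have hpos : 0 < ‖q 1 - q 0‖ := norm_pos_iff.mpr hne
      obtain ⟨j, hj⟩ := exists_nat_gt ((M + M) / ‖q 1 - q 0‖)
      rw [div_lt_iff₀ hpos] at hj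
      have h1 : ‖(j : ℂ) * (q 1 - q 0)‖ ≤ M + M := by
        have : (j : ℂ) * (q 1 - q 0) = q j - q 0 := by rw [hlin j]; ring
        rw [this]
        exact (norm_sub_le _ _).trans (add_le_add (hM _) (hM _))
      rw [norm_mul, Complex.norm_natCast] at h1
      linarith
    rw [hlin k, hc]; simp

theorem DiffOrder.iterate_eq_zero {n : ℕ} {f : G → ℂ} (hf : DiffOrder n f) (u : G) :
    (fwdDiff u)^[n] f = 0 := by
  induction n generalizing f with
  | zero => exact hf
  | succ n ih => exact ih (hf u)

theorem iterate_fwdDiff_nsmul (f : G → ℂ) (a u : G) (n k : ℕ) :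
    (fwdDiff 1)^[n] (fun j : ℕ => f (a + j • u)) k = (fwdDiff u)^[n] f (a + k • u) := by
  induction n generalizing f with
  | zero => rfl
  | succ n ih =>
    have : fwdDiff 1 (fun j : ℕ => f (a + j • u)) = fun j => fwdDiff u f (a + j • u) := by
      ext j
      simp [fwdDiff, add_smul, add_assoc]
    rw [Function.iterate_succ_apply, Function.iterate_succ_apply, this, ih]

end Algebra

/-! ### Finite order on connected groups: vanishing, continuity, uniform order -/

section Topological

variable {G H : Type*} [AddCommGroup G] [TopologicalSpace G]
  [AddCommGroup H]

theorem AddSubgroup.mem_of_mem_nhds_zero [IsTopologicalAddGroup G] [ConnectedSpace G]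
    (S : AddSubgroup G) (hS : ∀ᶠ h in 𝓝 (0 : G), h ∈ S) (x : G) : x ∈ S := by
  have hopen : IsOpen (S : Set G) := S.isOpen_of_mem_nhds hS
  have : (S : Set G) = Set.univ :=
    IsClopen.eq_univ ⟨S.isClosed_of_isOpen hopen, hopen⟩ ⟨0, S.zero_mem⟩
  exact SetLike.mem_coe.mp (this.symm ▸ Set.mem_univ x)

theorem eventually_eventually_add [IsTopologicalAddGroup G] {a : G} {P : G → Prop}
    (hP : ∀ᶠ x in 𝓝 a, P x) : ∀ᶠ h in 𝓝 (0 : G), ∀ᶠ x in 𝓝 a, P (x + h) := by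
  have ht : Tendsto (fun p : G × G => p.2 + p.1) (𝓝 0 ×ˢ 𝓝 a) (𝓝 a) := by
    have : Tendsto (fun p : G × G => p.2 + p.1) (𝓝 (0, a)) (𝓝 (a + 0)) :=
      (continuous_snd.add continuous_fst).tendsto _
    rwa [add_zero, nhds_prod_eq] at this
  exact (ht.eventually hP).curry

/-- For small `h` the difference vanishes near `a`, hence everywhere by induction. So the periods of
`f` contain a neighborhood of `0`, and by connectedness they are all of `G`. -/
theorem DiffOrder.eq_zero_of_eventually_eq_zero [IsTopologicalAddGroup G] [ConnectedSpace G]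
    {n : ℕ} {f : G → ℂ} (hf : DiffOrder n f) {a : G} (ha : ∀ᶠ x in 𝓝 a, f x = 0) :
    f = 0 := by
  induction n generalizing f with
  | zero => exact hf
  | succ n ih =>
    let S : AddSubgroup G :=
      { carrier := {h | ∀ x, f (x + h) = f x}
        zero_mem' := by simp
        add_mem' := fun {h k} hh hk x => by rw [← add_assoc, hk, hh]
        neg_mem' := fun {h} hh x => by rw [← hh (x + -h), neg_add_cancel_right] }
    have hS : ∀ᶠ h in 𝓝 (0 : G), h ∈ S := by
      filter_upwards [eventually_eventually_add ha] with h hh x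
      have : fwdDiff h f = 0 := ih (hf h) (by
        filter_upwards [hh, ha] with x h1 h2
        simp [fwdDiff, h1, h2])
      exact sub_eq_zero.mp (congrFun this x)
    ext x
    have := S.mem_of_mem_nhds_zero hS (x - a) a
    rw [add_sub_cancel, ha.self_of_nhds] at this
    exact this

/-- Along an ultrafilter `u → 0`, the values `f (a + k • u)` have limits `q k` by compactness. The
sequence `q` is bounded and of finite order, hence constant, so the limit `q 1` of `f (a + u)`
equals `q 0 = f a`. -/
theorem DiffOrder.continuousAt_of_bounded [IsTopologicalAddGroup G]
    {n : ℕ} {f : G → ℂ} (hf : DiffOrder n f) {a : G} {M : ℝ}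
    (ha : ∀ᶠ x in 𝓝 a, ‖f x‖ ≤ M) : ContinuousAt f a := by
  have hshift : Tendsto (fun u => f (a + u)) (𝓝 0) (𝓝 (f a)) := by
    rw [tendsto_iff_ultrafilter]
    intro U hU
    have hb (k : ℕ) : ∀ᶠ u in (U : Filter G), f (a + k • u) ∈ Metric.closedBall (0 : ℂ) M := by
      have ht : Tendsto (fun u : G => a + k • u) (𝓝 0) (𝓝 a) := by
        have : Tendsto (fun u : G => a + k • u) (𝓝 0) (𝓝 (a + k • (0 : G))) :=
          (continuous_const.add (continuous_id.nsmul k)).tendsto _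
        simpa using this
      filter_upwards [hU (ht.eventually ha)] with u hu
      simpa using hu
    have hlim (k : ℕ) : ∃ c ∈ Metric.closedBall (0 : ℂ) M,
        Tendsto (fun u => f (a + k • u)) (U : Filter G) (𝓝 c) := by
      obtain ⟨c, hc, hle⟩ := (isCompact_closedBall (0 : ℂ) M).ultrafilter_le_nhds
        (U.map fun u => f (a + k • u)) (le_principal_iff.mpr (hb k))
      exact ⟨c, hc, hle⟩
    choose q hqM hq using hlim
    have hdiff (m k : ℕ) : Tendsto (fun u => (fwdDiff 1)^[m] (fun j : ℕ => f (a + j • u)) k)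
        (U : Filter G) (𝓝 ((fwdDiff 1)^[m] q k)) := by
      induction m generalizing k with
      | zero => exact hq k
      | succ m ih =>
        simp only [Function.iterate_succ_apply']
        exact (ih (k + 1)).sub (ih k)
    have hz : (fwdDiff 1)^[n] q = 0 := by
      ext k
      refine tendsto_nhds_unique (hdiff n k) ?_
      simp only [iterate_fwdDiff_nsmul, hf.iterate_eq_zero]
      exact tendsto_const_nhds
    have h01 := eq_apply_zero_of_bounded_of_iterate_fwdDiff (M := M)
      (fun k => by simpa using hqM k) hz 1
    have h0 : q 0 = f a := by
      refine tendsto_nhds_unique (hq 0) ?_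
      simp only [zero_smul, add_zero]
      exact tendsto_const_nhds
    have h1 := hq 1
    simp only [one_smul, h01, h0] at h1
    exact h1
  have hsub : Tendsto (fun x : G => x - a) (𝓝 a) (𝓝 0) := by
    have : Tendsto (fun x : G => x - a) (𝓝 a) (𝓝 (a - a)) :=
      (continuous_id.sub continuous_const).tendsto _
    rwa [sub_self] at this
  simpa [ContinuousAt, Function.comp_def] using hshift.comp hsub

theorem DiffOrder.continuous_of_bounded [IsTopologicalAddGroup G] [ConnectedSpace G]
    {n : ℕ} {f : G → ℂ} (hf : DiffOrder n f) {a : G} {M : ℝ}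
    (ha : ∀ᶠ x in 𝓝 a, ‖f x‖ ≤ M) : Continuous f := by
  induction n generalizing f M with
  | zero =>
    obtain rfl : f = 0 := hf
    exact continuous_const
  | succ n ih =>
    -- By induction `S` contains all small `h`, hence all of `G`; a continuous difference then
    -- carries continuity from `a` to any `x`.
    let S : AddSubgroup G :=
      { carrier := {h | Continuous fun x => f (x + h) - f x}
        zero_mem' := by simpa using continuous_const
        add_mem' := fun {h k} hh hk => by
          have h1 : Continuous fun x => f (x + k + h) - f (x + k) :=
            Continuous.comp (g := fun x => f (x + h) - f x) hh (continuous_add_const k)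
          refine (h1.add hk).congr fun x => ?_
          simp only [Pi.add_apply, add_assoc x, add_comm k h]; ring
        neg_mem' := fun {h} hh => by
          have h1 : Continuous fun x => f (x + -h + h) - f (x + -h) :=
            Continuous.comp (g := fun x => f (x + h) - f x) hh (continuous_add_const (-h))
          refine h1.neg.congr fun x => ?_
          simp only [Pi.neg_apply, neg_add_cancel_right]; ring }
    have hS : ∀ᶠ h in 𝓝 (0 : G), h ∈ S := by
      filter_upwards [eventually_eventually_add ha] with h hh
      refine ih (f := fwdDiff h f) (M := M + M) (hf h) ?_
      filter_upwards [hh, ha] with x h1 h2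
      exact (norm_sub_le _ _).trans (add_le_add h1 h2)
    rw [continuous_iff_continuousAt]
    intro x
    have hx : Continuous fun y => f (y + (a - x)) - f y := S.mem_of_mem_nhds_zero hS (a - x)
    have hca : ContinuousAt (fun y => f (y + (a - x))) x := by
      refine ContinuousAt.comp (g := f) ?_ (continuous_add_const (a - x)).continuousAt
      rw [add_sub_cancel]
      exact hf.continuousAt_of_bounded ha
    refine (hca.sub hx.continuousAt).congr (Eventually.of_forall fun y => ?_)
    simp

theorem isClosed_setOf_diffOrder {X : Type*} [TopologicalSpace X] {F : X → H → ℂ}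
    (hF : ∀ y, Continuous fun x => F x y) (n : ℕ) : IsClosed {x | DiffOrder n (F x)} := by
  induction n generalizing F with
  | zero =>
    simp only [DiffOrder, funext_iff, Set.ofPred_forall]
    exact isClosed_iInter fun y => isClosed_eq (hF y) continuous_const
  | succ n ih =>
    simp only [DiffOrder, Set.ofPred_forall]
    exact isClosed_iInter fun h => ih fun y => (hF (y + h)).sub (hF y)

/-- Differencing in `H` reduces to `n = 0`, where the vanishing principle applies in `G` for each
fixed `y`. -/
theorem DiffOrder.of_eventually [IsTopologicalAddGroup G] [ConnectedSpace G]
    {F : G → H → ℂ} (hF : ∀ y, ∃ m, DiffOrder m fun x => F x y) {n : ℕ} {a : G}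
    (ha : ∀ᶠ x in 𝓝 a, DiffOrder n (F x)) (x : G) : DiffOrder n (F x) := by
  induction n generalizing F with
  | zero =>
    ext y
    obtain ⟨m, hm⟩ := hF y
    exact congrFun (hm.eq_zero_of_eventually_eq_zero (ha.mono fun x hx => congrFun hx y)) x
  | succ n ih =>
    intro h
    refine ih (F := fun x => fwdDiff h (F x)) (fun y => ?_) (ha.mono fun x hx => hx h)
    obtain ⟨m₁, h₁⟩ := hF (y + h)
    obtain ⟨m₂, h₂⟩ := hF y
    exact ⟨max m₁ m₂, (h₁.mono (le_max_left _ _)).sub (h₂.mono (le_max_right _ _))⟩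

/-- The orders of the sections in one variable are uniformly bounded. -/
theorem exists_uniform_diffOrder [IsTopologicalAddGroup G] [ConnectedSpace G] [BaireSpace G]
    {F : G → H → ℂ} (hc : ∀ y, Continuous fun x => F x y)
    (hG : ∀ y, ∃ m, DiffOrder m fun x => F x y) (hH : ∀ x, ∃ n, DiffOrder n (F x)) :
    ∃ n, ∀ x, DiffOrder n (F x) := by
  obtain ⟨n, a, ha⟩ := nonempty_interior_of_iUnion_of_closed
    (isClosed_setOf_diffOrder hc) (Set.eq_univ_of_forall fun x => Set.mem_iUnion.mpr (hH x))
  exact ⟨n, DiffOrder.of_eventually hG (mem_interior_iff_mem_nhds.mp ha)⟩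

end Topological

/-! ### Local boundedness and the theorem -/

/-- A separately continuous function on a product of a Baire space with a space that has a point
with a countable neighborhood basis or a compact neighborhood is bounded near some point. -/
theorem exists_eventually_norm_le_of_separately_continuous {X Y : Type*} [TopologicalSpace X]
    [TopologicalSpace Y] [BaireSpace X] [Nonempty X] {f : X × Y → ℂ}
    (hx : ∀ y, Continuous fun x => f (x, y)) (hy : ∀ x, Continuous fun y => f (x, y)) (b : Y)
    (hY : (𝓝 b).IsCountablyGenerated ∨ ∃ K ∈ 𝓝 b, IsCompact K) :
    ∃ (p : X × Y) (M : ℝ), ∀ᶠ z in 𝓝 p, ‖f z‖ ≤ M := by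
  -- The sets of `x` with `f (x, ·)` bounded by `k` on `V k` are closed and cover `X`; Baire gives
  -- one with interior.
  obtain ⟨V, hV, hcover⟩ : ∃ V : ℕ → Set Y, (∀ k, V k ∈ 𝓝 b) ∧
      ∀ x, ∃ k : ℕ, ∀ y ∈ V k, ‖f (x, y)‖ ≤ k := by
    rcases hY with hY | ⟨K, hK, hKc⟩
    · obtain ⟨V, hV⟩ := (𝓝 b).exists_antitone_basis
      refine ⟨V, hV.mem, fun x => ?_⟩
      have hev : ∀ᶠ y in 𝓝 b, ‖f (x, y)‖ < ‖f (x, b)‖ + 1 :=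
        (hy x).norm.continuousAt.eventually_lt continuousAt_const (by simp)
      obtain ⟨i, hi⟩ := hV.mem_iff.mp hev
      obtain ⟨j, hj⟩ := exists_nat_ge (‖f (x, b)‖ + 1)
      refine ⟨max i j, fun y hyV => ?_⟩
      have h1 : ‖f (x, y)‖ < ‖f (x, b)‖ + 1 := hi (hV.antitone (le_max_left i j) hyV)
      have h2 : (j : ℝ) ≤ (max i j : ℕ) := by exact_mod_cast le_max_right i j
      linarith
    · refine ⟨fun _ => K, fun _ => hK, fun x => ?_⟩
      obtain ⟨C, hC⟩ := hKc.exists_bound_of_continuousOn (hy x).continuousOn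
      obtain ⟨j, hj⟩ := exists_nat_ge C
      exact ⟨j, fun y hyK => (hC y hyK).trans hj⟩
  obtain ⟨k, a, ha⟩ := nonempty_interior_of_iUnion_of_closed
    (f := fun k : ℕ => {x | ∀ y ∈ V k, ‖f (x, y)‖ ≤ k})
    (fun k => by
      simp only [Set.ofPred_forall]
      exact isClosed_iInter fun y => isClosed_iInter fun _ =>
        isClosed_le (hx y).norm continuous_const)
    (Set.eq_univ_of_forall fun x => Set.mem_iUnion.mpr (hcover x))
  refine ⟨(a, b), k, ?_⟩
  filter_upwards [prod_mem_nhds (mem_interior_iff_mem_nhds.mp ha) (hV k)] with z hz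
  exact hz.1 z.2 hz.2

theorem theorem3 {G : Type*} {H : Type*}
    [AddCommGroup G] [TopologicalSpace G] [IsTopologicalAddGroup G]
    [AddCommGroup H] [TopologicalSpace H] [IsTopologicalAddGroup H]
    [ConnectedSpace G] [ConnectedSpace H] [BaireSpace G] [BaireSpace H]
    (hGH : (TopologicalSpace.MetrizableSpace G ∨ TopologicalSpace.MetrizableSpace H) ∨
      (LocallyCompactSpace G ∧ LocallyCompactSpace H))
    (f : G × H → ℂ) (hf : IsSeparatelyGeneralizedPolynomial f) :
    IsGeneralizedPolynomial f := by
  obtain ⟨hfx, hfy⟩ := hf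
  have hG (y : H) : ∃ m, DiffOrder m fun x => f (x, y) :=
    (hfy y).2.imp' (· + 1) fun _ h => diffOrder_iff_foldr.mpr h
  have hH (x : G) : ∃ n, DiffOrder n fun y => f (x, y) :=
    (hfx x).2.imp' (· + 1) fun _ h => diffOrder_iff_foldr.mpr h
  have hcx (y : H) : Continuous fun x => f (x, y) := (hfy y).1
  have hcy (x : G) : Continuous fun y => f (x, y) := (hfx x).1
  obtain ⟨n, hn⟩ := exists_uniform_diffOrder (F := fun x y => f (x, y)) hcx hG hH
  obtain ⟨m, hm⟩ := exists_uniform_diffOrder (F := fun y x => f (x, y)) hcy hH hG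
  have hord : DiffOrder (m + n) f := DiffOrder.prod le_rfl hm hn
  obtain ⟨p, M, hp⟩ : ∃ (p : G × H) (M : ℝ), ∀ᶠ z in 𝓝 p, ‖f z‖ ≤ M := by
    rcases hGH with (hmG | hmH) | ⟨-, hlH⟩
    -- The swap puts the metrizable factor second, where the countable basis is needed.
    · obtain ⟨p, M, hp⟩ := exists_eventually_norm_le_of_separately_continuous
        (f := fun z : H × G => f z.swap) hcy hcx (0 : G) (Or.inl inferInstance)
      exact ⟨p.swap, M, (continuous_swap.tendsto p.swap).eventually hp⟩
    · exact exists_eventually_norm_le_of_separately_continuous hcx hcy (0 : H)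
        (Or.inl inferInstance)
    · obtain ⟨K, hKc, hK⟩ := exists_compact_mem_nhds (0 : H)
      exact exists_eventually_norm_le_of_separately_continuous hcx hcy (0 : H)
        (Or.inr ⟨K, hK, hKc⟩)
  -- Degree `m + n` means `m + n + 1` differences, hence `succ`.
  exact ⟨hord.continuous_of_bounded hp, m + n, diffOrder_iff_foldr.mp hord.succ⟩
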